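/- Let \(q\ge 1\) be an integer, \(\alpha\in\mathbb R\), \(\kappa\in\{1,2,3,\dots\}\cup\{\infty\}\) (with \(\infty-1:=\infty\)), and let \((s_j)_{j=0}^{\kappa}\) be a sequence of complex \(q\times q\) matrices. **The transform.** \(A^\dagger\) denotes the Moore–Penrose inverse. Put \(u_0:=s_0\) and \(u_j:=-\alpha s_{j-1}+s_j\) for \(1\le j\le\kappa\). Define \(s_0^{\langle\alpha\rangle}:=u_0^\dagger\) and \(s_j^{\langle\alpha\rangle}:=-u_0^\dagger\sum_{l=0}^{j-1}u_{j-l}\,s_l^{\langle\alpha\rangle}\) for \(1\le j\le\kappa\). The transformed sequence is \(t_j:=-s_{j+1}^{\langle\alpha\rangle}\), \(0\le j\le\kappa-1\). **The classes.** For a sequence \((x_j)\) of complex \(q\times q\) matrices let \(H_n(x):=(x_{j+k})_{j,k=0}^n\), \(x^{(\alpha)}_j:=-\alpha x_j+x_{j+1}\), \(L_0(x):=x_0\), and for \(n\ge1\) \[L_n(x):=x_{2n}-(x_n,\dots,x_{2n-1})\,H_{n-1}(x)^\dagger\begin{pmatrix}x_n\\ \vdots\\ x_{2n-1}\end{pmatrix}.\]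 * \(\mathcal K^{\ge}_{m}\) (\(m\in\mathbb N_0\)) is the set of all \((x_j)_{j=0}^m\) such that: \(H_0(x)\) is non-negative Hermitian, if \(m=0\); \(H_n(x)\) and \(H_{n-1}(x^{(\alpha)})\) are non-negative Hermitian, if \(m=2n\) with \(n\ge1\); \(H_n(x)\) and \(H_n(x^{(\alpha)})\) are non-negative Hermitian, if \(m=2n+1\). \(\mathcal K^{>}_m\) is defined in the same way with "positive definite Hermitian" in place of "non-negative Hermitian". * \(\mathcal K^{\ge}_\infty\) (resp. \(\mathcal K^{>}_\infty\)) is the set of all \((x_j)_{j=0}^\infty\) with \((x_j)_{j=0}^m\in\mathcal K^{\ge}_m\) (resp. \(\mathcal K^{>}_m\)) for all \(m\in\mathbb N_0\). * \(\mathcal K^{\ge,e}_m\) (\(m\in\mathbb N_0\)) is the set of all \((x_j)_{j=0}^m\) for which there is a complex \(q\times q\) matrix \(x_{m+1}\) with \((x_j)_{j=0}^{m+1}\in\mathcal K^{\ge}_{m+1}\); and \(\mathcal K^{\ge,e}_\infty:=\mathcal K^{\ge}_\infty\). * \(\mathcal K^{\ge,cd}_{m}\) (\(m\in\mathbb N_0\))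 is the set of all \((x_j)_{j=0}^m\in\mathcal K^{\ge}_m\) such that, if \(m=2n\), \(H_n(x)\) is non-negative Hermitian and \(L_n(x)=0\), and, if \(m=2n+1\), \(H_n(x^{(\alpha)})\) is non-negative Hermitian and \(L_n(x^{(\alpha)})=0\). \(\mathcal K^{\ge,cd}_\infty\) is the set of all \((x_j)_{j=0}^\infty\in\mathcal K^{\ge}_\infty\) such that \((x_j)_{j=0}^m\in\mathcal K^{\ge,cd}_m\) for some \(m\in\mathbb N_0\). * \(\mathcal K^{\ge,cd,m}_{\lambda}\) (\(\lambda\in\mathbb N_0\cup\{\infty\}\), \(m\in\mathbb N_0\), \(m\le\lambda\)) is the set of all \((x_j)_{j=0}^{\lambda}\in\mathcal K^{\ge}_{\lambda}\) with \((x_j)_{j=0}^m\in\mathcal K^{\ge,cd}_m\). **Proposition P1542.** With this notation: 1. If \((s_j)_{j=0}^\kappa\in\mathcal K^{\ge}_\kappa\), then \((t_j)_{j=0}^{\kappa-1}\in\mathcal K^{\ge}_{\kappa-1}\). 2. If \((s_j)_{j=0}^\kappa\in\mathcal K^{\ge,e}_\kappa\), then \((t_j)_{j=0}^{\kappa-1}\in\mathcal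 K^{\ge,e}_{\kappa-1}\). 3. If \((s_j)_{j=0}^\kappa\in\mathcal K^{>}_\kappa\), then \((t_j)_{j=0}^{\kappa-1}\in\mathcal K^{>}_{\kappa-1}\). 4. If \(m\in\mathbb N_0\), \(m\le\kappa\), and \((s_j)_{j=0}^\kappa\in\mathcal K^{\ge,cd,m}_{\kappa}\), then \((t_j)_{j=0}^{\kappa-1}\in\mathcal K^{\ge,cd,\max\{0,m-1\}}_{\kappa-1}\). 5. If \((s_j)_{j=0}^\kappa\in\mathcal K^{\ge,cd}_\kappa\), then \((t_j)_{j=0}^{\kappa-1}\in\mathcal K^{\ge,cd}_{\kappa-1}\). -/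

import Mathlib

open scoped Matrix ComplexOrder

noncomputable section

namespace StieltjesSeq

/-! ### The Moore–Penrose inverse -/

/-- The four Penrose equations: `X` is the Moore–Penrose inverse of `A`. -/
structure IsMoorePenrose {m n : Type*} [Fintype m] [Fintype n]
    (A : Matrix m n ℂ) (X : Matrix n m ℂ) : Prop where
  mul_mul_left : A * X * A = A
  mul_mul_right : X * A * X = X
  isHermitian_left : (A * X)ᴴ = A * X
  isHermitian_right : (X * A)ᴴ = X * A

/-- A Hermitian matrix has a Hermitian Moore–Penrose inverse, which commutes with it. -/
theorem exists_pinv_of_isHermitian {n : Type*} [Fintype n] [DecidableEq n]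
    (B : Matrix n n ℂ) (hB : B.IsHermitian) :
    ∃ Y : Matrix n n ℂ, B * Y * B = B ∧ Y * B * Y = Y ∧ Yᴴ = Y ∧ B * Y = Y * B := by
  obtain ⟨U, d, hU, hU', hBd⟩ : ∃ (U : Matrix n n ℂ) (d : n → ℝ), Uᴴ * U = 1 ∧ U * Uᴴ = 1 ∧
      B = U * Matrix.diagonal (fun i => (d i : ℂ)) * Uᴴ := by
    refine ⟨hB.eigenvectorUnitary, hB.eigenvalues, ?_, ?_, ?_⟩
    · simpa [Matrix.star_eq_conjTranspose] using
        (Matrix.mem_unitaryGroup_iff'.mp hB.eigenvectorUnitary.2)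
    · simpa [Matrix.star_eq_conjTranspose] using
        (Matrix.mem_unitaryGroup_iff.mp hB.eigenvectorUnitary.2)
    · have h := hB.spectral_theorem
      rw [Unitary.conjStarAlgAut_apply] at h
      simpa [Matrix.star_eq_conjTranspose, Function.comp_def] using h
  have key : ∀ D E : Matrix n n ℂ, (U * D * Uᴴ) * (U * E * Uᴴ) = U * (D * E) * Uᴴ := by
    intro D E
    calc (U * D * Uᴴ) * (U * E * Uᴴ) = U * D * (Uᴴ * U) * E * Uᴴ := by
          simp only [Matrix.mul_assoc]
      _ = U * (D * E) * Uᴴ := by rw [hU]; simp only [Matrix.mul_assoc, Matrix.mul_one]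
  refine ⟨U * Matrix.diagonal (fun i => ((d i : ℂ))⁻¹) * Uᴴ, ?_, ?_, ?_, ?_⟩
  · rw [hBd, key, key, Matrix.diagonal_mul_diagonal, Matrix.diagonal_mul_diagonal]
    congr 3
    ext1 i
    exact mul_inv_mul_cancel _
  · rw [hBd, key, key, Matrix.diagonal_mul_diagonal, Matrix.diagonal_mul_diagonal]
    congr 3
    ext1 i
    by_cases h : (d i : ℂ) = 0 <;> simp [h]
  · simp only [Matrix.conjTranspose_mul, Matrix.conjTranspose_conjTranspose,
      Matrix.diagonal_conjTranspose, Matrix.mul_assoc]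
    congr 3
    ext1 i
    simp
  · rw [hBd, key, key, Matrix.diagonal_mul_diagonal, Matrix.diagonal_mul_diagonal]
    congr 3
    ext1 i
    exact mul_comm _ _

/-- Every complex matrix has a Moore–Penrose inverse. -/
theorem exists_isMoorePenrose {m n : Type*} [Fintype m] [Fintype n]
    (A : Matrix m n ℂ) : ∃ X : Matrix n m ℂ, IsMoorePenrose A X := by
  classical
  obtain ⟨Y, h1, h2, h3, h4⟩ := exists_pinv_of_isHermitian (Aᴴ * A)
    (Matrix.isHermitian_conjTranspose_mul_self A)
  have hP : (Y * (Aᴴ * A))ᴴ = Y * (Aᴴ * A) := by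
    rw [Matrix.conjTranspose_mul, h3, Matrix.conjTranspose_mul,
      Matrix.conjTranspose_conjTranspose, h4]
  have hA : A * (Y * (Aᴴ * A)) = A := by
    have h0 : (A - A * (Y * (Aᴴ * A)))ᴴ * (A - A * (Y * (Aᴴ * A))) = 0 := by
      have e : (Aᴴ * A) * (Y * (Aᴴ * A)) = Aᴴ * A := by rw [← Matrix.mul_assoc, h1]
      rw [Matrix.conjTranspose_sub, Matrix.conjTranspose_mul, hP, Matrix.sub_mul,
        Matrix.mul_sub, Matrix.mul_assoc, ← Matrix.mul_assoc Aᴴ A, e, sub_self, zero_sub,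
        Matrix.mul_sub, ← Matrix.mul_assoc Aᴴ A, e, sub_self, Matrix.mul_zero, neg_zero]
    exact (sub_eq_zero.mp (Matrix.conjTranspose_mul_self_eq_zero.mp h0)).symm
  refine ⟨Y * Aᴴ, ⟨?_, ?_, ?_, ?_⟩⟩
  · rw [Matrix.mul_assoc, Matrix.mul_assoc Y, hA]
  · rw [Matrix.mul_assoc Y, ← Matrix.mul_assoc, h2]
  · rw [Matrix.conjTranspose_mul, Matrix.conjTranspose_mul, Matrix.conjTranspose_conjTranspose,
      h3, Matrix.mul_assoc]
  · rw [Matrix.mul_assoc, hP]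

/-- The Moore–Penrose inverse `A^†` is unique. -/
theorem IsMoorePenrose.unique {m n : Type*} [Fintype m] [Fintype n]
    {A : Matrix m n ℂ} {X Y : Matrix n m ℂ} (hX : IsMoorePenrose A X)
    (hY : IsMoorePenrose A Y) : X = Y := by
  have e1 : A * X = A * Y := by
    calc A * X = (A * Y) * (A * X) := by rw [← Matrix.mul_assoc, hY.mul_mul_left]
      _ = ((A * X) * (A * Y))ᴴ := by
        rw [Matrix.conjTranspose_mul (A * X), hX.isHermitian_left, hY.isHermitian_left]
      _ = A * Y := by rw [← Matrix.mul_assoc, hX.mul_mul_left, hY.isHermitian_left]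
  have e2 : X * A = Y * A := by
    calc X * A = (X * A) * (Y * A) := by
          rw [Matrix.mul_assoc, ← Matrix.mul_assoc A, hY.mul_mul_left]
      _ = ((Y * A) * (X * A))ᴴ := by
        rw [Matrix.conjTranspose_mul (Y * A), hX.isHermitian_right, hY.isHermitian_right]
      _ = Y * A := by
        rw [Matrix.mul_assoc, ← Matrix.mul_assoc A, hX.mul_mul_left, hY.isHermitian_right]
  calc X = X * A * X := hX.mul_mul_right.symm
    _ = Y * A * Y := by rw [e2, Matrix.mul_assoc, e1, ← Matrix.mul_assoc]
    _ = Y := hY.mul_mul_right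

/-- The Moore–Penrose inverse `A^†`. -/
def pinv {m n : Type*} [Fintype m] [Fintype n] (A : Matrix m n ℂ) : Matrix n m ℂ :=
  Classical.choose (exists_isMoorePenrose A)

theorem isMoorePenrose_pinv {m n : Type*} [Fintype m] [Fintype n] (A : Matrix m n ℂ) :
    IsMoorePenrose A (pinv A) :=
  Classical.choose_spec (exists_isMoorePenrose A)

/-! ### Sequences and the transforms

A sequence `(s_j)_{j=0}^κ` of complex `p × q` matrices is represented by a function `s` on `ℕ`,
of which only the values `s j` with `j ≤ κ` matter: for a sequence of length `κ`, every notion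
below looks only at `s 0, …, s κ`. -/

variable {p q : ℕ}

/-- The right α-shifted sequence `-α s_j + s_{j+1}`, `0 ≤ j ≤ κ - 1`. -/
def shiftSeq (α : ℂ) (s : ℕ → Matrix (Fin p) (Fin q) ℂ) : ℕ → Matrix (Fin p) (Fin q) ℂ :=
  fun j => -(α • s j) + s (j + 1)

/-- The `[+,α]`-transform `-α s_{j-1} + s_j`, `0 ≤ j ≤ κ`, where `s_{-1} = 0`. -/
def plusSeq (α : ℂ) (s : ℕ → Matrix (Fin p) (Fin q) ℂ) : ℕ → Matrix (Fin p) (Fin q) ℂ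
  | 0 => s 0
  | j + 1 => -(α • s j) + s (j + 1)

/-- The reciprocal sequence: `s_0^# = s_0^†` and
`s_j^# = - s_0^† ∑_{l=0}^{j-1} s_{j-l} s_l^#` for `j ≥ 1`. -/
def recipSeq (s : ℕ → Matrix (Fin p) (Fin q) ℂ) : ℕ → Matrix (Fin q) (Fin p) ℂ
  | 0 => pinv (s 0)
  | j + 1 => -(pinv (s 0) * ∑ l : Fin (j + 1), s (j + 1 - (l : ℕ)) * recipSeq s l)

/-- The sequence `-s_{j+1}^{⟨α⟩}`, `0 ≤ j ≤ κ - 1`, where `s^{⟨α⟩}` is the reciprocal sequence of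
the `[+,α]`-transform of `s`. -/
def shortNegRecip (α : ℂ) (s : ℕ → Matrix (Fin p) (Fin q) ℂ) : ℕ → Matrix (Fin q) (Fin p) ℂ :=
  fun j => -recipSeq (plusSeq α s) (j + 1)

/-! ### Block Hankel matrices -/

/-- The block Hankel matrix `H_n = (s_{j+k})_{j,k=0}^n`. -/
def blockHankel (s : ℕ → Matrix (Fin p) (Fin q) ℂ) (n : ℕ) :
    Matrix (Fin (n + 1) × Fin p) (Fin (n + 1) × Fin q) ℂ :=
  Matrix.of fun a b => s ((a.1 : ℕ) + (b.1 : ℕ)) a.2 b.2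

/-- The block column `col (s_l, …, s_{l+n})`. -/
def blockCol (s : ℕ → Matrix (Fin p) (Fin q) ℂ) (l n : ℕ) :
    Matrix (Fin (n + 1) × Fin p) (Fin q) ℂ :=
  Matrix.of fun a b => s (l + (a.1 : ℕ)) a.2 b

/-- The block row `(s_l, …, s_{l+n})`. -/
def blockRow (s : ℕ → Matrix (Fin p) (Fin q) ℂ) (l n : ℕ) :
    Matrix (Fin p) (Fin (n + 1) × Fin q) ℂ :=
  Matrix.of fun a b => s (l + (b.1 : ℕ)) a b.2

/-- `L_0 = s_0` and `L_n = s_{2n} - (s_n, …, s_{2n-1}) H_{n-1}^† col (s_n, …, s_{2n-1})` for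
`n ≥ 1`. -/
def schurL (s : ℕ → Matrix (Fin p) (Fin q) ℂ) : ℕ → Matrix (Fin p) (Fin q) ℂ
  | 0 => s 0
  | n + 1 => s (2 * (n + 1)) -
      blockRow s (n + 1) n * pinv (blockHankel s n) * blockCol s (n + 1) n

/-! ### The classes of sequences of `q × q` matrices -/

/-- `(s_j)_{j=0}^{2n}` is Hankel non-negative definite and completely degenerate. -/
def HankelCD (n : ℕ) (s : ℕ → Matrix (Fin q) (Fin q) ℂ) : Prop :=
  (blockHankel s n).PosSemidef ∧ schurL s n = 0

/-- The class `K^≥` for `(s_j)_{j=0}^m`, `m` finite. For `m = 0` the condition is `H_0 ≥ 0`. For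
`m = 2n ≥ 2` it says that `H_n` and the `H_{n-1}` of the shifted sequence are `≥ 0`, and for
`m = 2n + 1` that `H_n` and the `H_n` of the shifted sequence are `≥ 0`. -/
def KGeFin (α : ℝ) (m : ℕ) (s : ℕ → Matrix (Fin q) (Fin q) ℂ) : Prop :=
  (blockHankel s (m / 2)).PosSemidef ∧
    (1 ≤ m → (blockHankel (shiftSeq (α : ℂ) s) ((m - 1) / 2)).PosSemidef)

/-- The class `K^≥` for `(s_j)_{j=0}^κ`, `κ ∈ ℕ₀ ∪ {∞}`. -/
def KGe (α : ℝ) (κ : ℕ∞) (s : ℕ → Matrix (Fin q) (Fin q) ℂ) : Prop :=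
  match κ with
  | ⊤ => ∀ m : ℕ, KGeFin α m s
  | (m : ℕ) => KGeFin α m s

/-- The class `K^{≥,e}`: for finite `κ = m` there is a matrix `s_{m+1}` such that
`(s_j)_{j=0}^{m+1}` belongs to `K^≥`; for `κ = ∞` it is `K^≥`. -/
def KGeExt (α : ℝ) (κ : ℕ∞) (s : ℕ → Matrix (Fin q) (Fin q) ℂ) : Prop :=
  match κ with
  | ⊤ => KGe α ⊤ s
  | (m : ℕ) => ∃ A : Matrix (Fin q) (Fin q) ℂ, KGeFin α (m + 1) (Function.update s (m + 1) A)

/-- The class `K^>` for `(s_j)_{j=0}^m`, `m` finite: as `KGeFin`, with positive definite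
matrices. -/
def KGtFin (α : ℝ) (m : ℕ) (s : ℕ → Matrix (Fin q) (Fin q) ℂ) : Prop :=
  (blockHankel s (m / 2)).PosDef ∧
    (1 ≤ m → (blockHankel (shiftSeq (α : ℂ) s) ((m - 1) / 2)).PosDef)

/-- The class `K^>` for `(s_j)_{j=0}^κ`, `κ ∈ ℕ₀ ∪ {∞}`. -/
def KGt (α : ℝ) (κ : ℕ∞) (s : ℕ → Matrix (Fin q) (Fin q) ℂ) : Prop :=
  match κ with
  | ⊤ => ∀ m : ℕ, KGtFin α m s
  | (m : ℕ) => KGtFin α m s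

/-- The class `K^{≥,cd}` for `(s_j)_{j=0}^m`, `m` finite: the sequence is in `K^≥` and
`(s_j)_{j=0}^{2n}` (if `m = 2n`) resp. the shifted sequence up to `2n` (if `m = 2n + 1`) is
completely degenerate. -/
def KCDFin (α : ℝ) (m : ℕ) (s : ℕ → Matrix (Fin q) (Fin q) ℂ) : Prop :=
  KGeFin α m s ∧
    ((Even m → HankelCD (m / 2) s) ∧ (Odd m → HankelCD (m / 2) (shiftSeq (α : ℂ) s)))

/-- The class `K^{≥,cd}` for `(s_j)_{j=0}^κ`, `κ ∈ ℕ₀ ∪ {∞}`. -/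
def KCD (α : ℝ) (κ : ℕ∞) (s : ℕ → Matrix (Fin q) (Fin q) ℂ) : Prop :=
  match κ with
  | ⊤ => KGe α ⊤ s ∧ ∃ m : ℕ, KCDFin α m s
  | (m : ℕ) => KCDFin α m s

/-- The class `K^{≥,cd,m}` of the sequences `(s_j)_{j=0}^κ` in `K^≥` for which `(s_j)_{j=0}^m` is
in `K^{≥,cd}`, where `m ≤ κ`. -/
def KCDAt (α : ℝ) (m : ℕ) (κ : ℕ∞) (s : ℕ → Matrix (Fin q) (Fin q) ℂ) : Prop :=
  KGe α κ s ∧ KCDFin α m s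

end StieltjesSeq

end

namespace StieltjesSeq

/-!
Put `P = s₀ s₀†`. As power series with matrix coefficients, `u = ∑ u_j z^j` and its reciprocal `g`
are inverse to each other in the corner cut out by `P`, and since `u = (1 - α z) s`, so are `s` and
`(1 - α z) g`. If `g` is the corner inverse of `u`, then, by the Bezoutian identity, the lower
triangular Toeplitz matrix of `g` transforms the Hankel matrix of `(u_{j+1})` by congruence into the
Hankel matrix of `(-g_{j+1})`. Applied to the two pairs above, this makes the block Hankel matrices
of the transformed sequence (block submatrices of) congruent images of the block Hankel matrices of
the shifted and of the given sequence, so that non-negativity and positivity carry over.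

Complete degeneracy carries over because, for a non-negative Hermitian block Hankel matrix, the
Schur complement `L_n` vanishes if and only if the kernel contains a block vector with last block
`1`, and the congruence maps such kernel vectors to each other. This needs `s_j P = s_j`, which
holds for all entries of the sequence but the last.
-/

variable {q : ℕ}

/-! ### Moore–Penrose inverses and non-negative Hermitian matrices -/

section Matrices

variable {m n : Type*} [Fintype m] [Fintype n]

theorem IsMoorePenrose.conjTranspose {A : Matrix m n ℂ} {X : Matrix n m ℂ}
    (h : IsMoorePenrose A X) : IsMoorePenrose Aᴴ Xᴴ where
  mul_mul_left := by
    rw [← Matrix.conjTranspose_mul, ← Matrix.conjTranspose_mul, ← Matrix.mul_assoc,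
      h.mul_mul_left]
  mul_mul_right := by
    rw [← Matrix.conjTranspose_mul, ← Matrix.conjTranspose_mul, ← Matrix.mul_assoc,
      h.mul_mul_right]
  isHermitian_left := by
    rw [← Matrix.conjTranspose_mul, h.isHermitian_right, h.isHermitian_right]
  isHermitian_right := by
    rw [← Matrix.conjTranspose_mul, h.isHermitian_left, h.isHermitian_left]

theorem pinv_conjTranspose (A : Matrix m n ℂ) : pinv Aᴴ = (pinv A)ᴴ :=
  (isMoorePenrose_pinv Aᴴ).unique (isMoorePenrose_pinv A).conjTranspose

theorem commute_pinv_of_isHermitian {A : Matrix m m ℂ} (hA : A.IsHermitian) :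
    Commute A (pinv A) := by
  have h := (isMoorePenrose_pinv A).isHermitian_left
  rw [Matrix.conjTranspose_mul, ← pinv_conjTranspose, hA.eq] at h
  exact h.symm

theorem mul_pinv_mul_pinv {A : Matrix m m ℂ} (hA : A.IsHermitian) :
    A * pinv A * pinv A = pinv A := by
  rw [(commute_pinv_of_isHermitian hA).eq, (isMoorePenrose_pinv A).mul_mul_right]

theorem pinv_zero : pinv (0 : Matrix m n ℂ) = 0 := by
  simpa using (isMoorePenrose_pinv (0 : Matrix m n ℂ)).mul_mul_right.symm

theorem mul_pinv_of_isUnit [DecidableEq m] {A : Matrix m m ℂ} (hA : IsUnit A) :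
    A * pinv A = 1 :=
  hA.mul_right_cancel <| by rw [(isMoorePenrose_pinv A).mul_mul_left, one_mul]

theorem mul_eq_zero_of_conjTranspose_mul_mul_eq_zero {l : Type*} {H : Matrix m m ℂ}
    (hH : H.PosSemidef) {V : Matrix m l ℂ} (h : Vᴴ * (H * V) = 0) : H * V = 0 := by
  classical
  obtain ⟨B, rfl⟩ : ∃ B : Matrix m m ℂ, H = Bᴴ * B := by
    open scoped MatrixOrder in
    exact CStarAlgebra.nonneg_iff_eq_star_mul_self.mp hH.nonneg
  have hBV : B * V = 0 := by
    rw [← Matrix.conjTranspose_mul_self_eq_zero, Matrix.conjTranspose_mul, ← h]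
    simp only [Matrix.mul_assoc]
  rw [Matrix.mul_assoc, hBV, Matrix.mul_zero]

end Matrices

section SchurComplement

variable {m n : Type*} [Fintype m] [Finite n]
  {A : Matrix m m ℂ} {B : Matrix m n ℂ} {C : Matrix n m ℂ} {D : Matrix n n ℂ}

theorem mul_eq_zero_of_posSemidef_fromBlocks {l : Type*} {Q : Matrix m l ℂ}
    (h : (Matrix.fromBlocks A B C D).PosSemidef) (hQ : A * Q = 0) : C * Q = 0 := by
  cases nonempty_fintype n
  have hV : Matrix.fromBlocks A B C D * Matrix.fromRows Q (0 : Matrix n l ℂ) =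
      Matrix.fromRows 0 (C * Q) := by
    simp [Matrix.fromBlocks_mul_fromRows, hQ]
  have h0 := mul_eq_zero_of_conjTranspose_mul_mul_eq_zero (V := Matrix.fromRows Q 0) h <| by
    simp [hV, Matrix.conjTranspose_fromRows_eq_fromCols_conjTranspose,
      Matrix.fromCols_mul_fromRows]
  rw [hV, ← Matrix.fromRows_zero] at h0
  exact (Matrix.fromRows_inj h0).2

theorem schur_complement_eq_zero_iff (h : (Matrix.fromBlocks A B C D).PosSemidef) :
    D - C * pinv A * B = 0 ↔ ∃ X : Matrix m n ℂ, A * X + B = 0 ∧ C * X + D = 0 := by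
  classical
  obtain ⟨hA, hB, hC, -⟩ := Matrix.isHermitian_fromBlocks_iff.mp h.isHermitian
  have hMP := isMoorePenrose_pinv A
  have hAB : A * pinv A * B = B := by
    have hCA : C * (1 - pinv A * A) = 0 := mul_eq_zero_of_posSemidef_fromBlocks h <| by
      rw [Matrix.mul_sub, Matrix.mul_one, ← Matrix.mul_assoc, hMP.mul_mul_left, sub_self]
    rw [Matrix.mul_sub, Matrix.mul_one, sub_eq_zero] at hCA
    rw [← hC, ← hMP.isHermitian_left, ← Matrix.conjTranspose_mul,
      (commute_pinv_of_isHermitian hA).eq, ← hCA]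
  constructor
  · intro hD
    refine ⟨-(pinv A * B), ?_, ?_⟩
    · rw [Matrix.mul_neg, ← Matrix.mul_assoc, hAB, neg_add_cancel]
    · rw [← hD, Matrix.mul_neg, Matrix.mul_assoc, neg_add_eq_sub]
  · rintro ⟨X, hX, hD⟩
    obtain rfl := eq_neg_of_add_eq_zero_right hX
    obtain rfl := eq_neg_of_add_eq_zero_right hD
    rw [← hB, Matrix.conjTranspose_neg, Matrix.conjTranspose_mul, hA.eq]
    simp only [Matrix.neg_mul, Matrix.mul_neg, neg_neg, Matrix.mul_assoc]
    rw [← Matrix.mul_assoc (pinv A), ← Matrix.mul_assoc A, ← Matrix.mul_assoc A (pinv A),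
      hMP.mul_mul_left, sub_self]

end SchurComplement

/-! ### Initial segments of a sequence -/

section Congr

variable {p q : ℕ} {s t : ℕ → Matrix (Fin p) (Fin q) ℂ} {m : ℕ}

theorem blockHankel_congr (h : ∀ j ≤ 2 * m, s j = t j) : blockHankel s m = blockHankel t m := by
  ext a b
  simp only [blockHankel, Matrix.of_apply]
  rw [h _ (by omega)]

theorem shiftSeq_congr (α : ℂ) (h : ∀ j ≤ m + 1, s j = t j) {j : ℕ} (hj : j ≤ m) :
    shiftSeq α s j = shiftSeq α t j := by
  rw [shiftSeq, shiftSeq, h j (by omega), h (j + 1) (by omega)]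

theorem plusSeq_congr (α : ℂ) (h : ∀ j ≤ m, s j = t j) {j : ℕ} (hj : j ≤ m) :
    plusSeq α s j = plusSeq α t j := by
  cases j with
  | zero => exact h 0 hj
  | succ j => rw [plusSeq, plusSeq, h j (by omega), h (j + 1) hj]

theorem recipSeq_congr (h : ∀ j ≤ m, s j = t j) {j : ℕ} (hj : j ≤ m) :
    recipSeq s j = recipSeq t j := by
  induction j using Nat.strong_induction_on with
  | _ j ih =>
    cases j with
    | zero => rw [recipSeq, recipSeq, h 0 hj]
    | succ j =>
      rw [recipSeq, recipSeq, h 0 (Nat.zero_le _)]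
      congr 2
      refine Finset.sum_congr rfl fun l _ => ?_
      rw [ih l l.2 (by omega), h _ (by omega)]

theorem shortNegRecip_congr (α : ℂ) (h : ∀ j ≤ m + 1, s j = t j) {j : ℕ} (hj : j ≤ m) :
    shortNegRecip α s j = shortNegRecip α t j := by
  rw [shortNegRecip, shortNegRecip,
    recipSeq_congr (fun _ => plusSeq_congr α h) (Nat.succ_le_succ hj)]

theorem recipSeq_eq_zero (hs : s 0 = 0) (j : ℕ) : recipSeq s j = 0 := by
  cases j <;> simp [recipSeq, hs, pinv_zero]

end Congr

/-! ### Power series -/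

section PowerSeries

open PowerSeries Finset.HasAntidiagonal

variable {R : Type*} [Semiring R]

/-- The power series `∑ f_{i+n} X^i` that remains of `f` after deleting the first `n`
coefficients. -/
noncomputable def tail (n : ℕ) (f : R⟦X⟧) : R⟦X⟧ := PowerSeries.mk fun i => coeff (i + n) f

theorem coeff_tail (n i : ℕ) (f : R⟦X⟧) : coeff i (tail n f) = coeff (i + n) f := coeff_mk _ _

theorem tail_zero (f : R⟦X⟧) : tail 0 f = f := by ext; simp [coeff_tail]

theorem tail_tail (m n : ℕ) (f : R⟦X⟧) : tail m (tail n f) = tail (m + n) f := by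
  ext; simp [coeff_tail, add_assoc]

theorem C_coeff_add_X_mul_tail (n : ℕ) (f : R⟦X⟧) :
    C (coeff n f) + X * tail (n + 1) f = tail n f := by
  ext i
  cases i with
  | zero => simp [coeff_tail]
  | succ i => simp [coeff_tail, coeff_succ_X_mul, add_assoc, add_comm 1 n]

/-- `g` is the inverse of `P u P` in the corner `P R⟦X⟧ P` cut out by an idempotent `P` of the
coefficient ring. -/
structure IsCornerInverse (P : R) (u g : R⟦X⟧) : Prop where
  proj_mul : C P * g = g
  mul_proj : g * C P = g
  proj_mul_mul : C P * u * g = C P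
  mul_mul_proj : g * u * C P = C P

/-- The `k`-th column `∑_i (∑_{l ≤ k} u_{i+k-l} g_l) X^i` of the product of the Hankel matrix
`(u_{i+j})` and the upper triangular Toeplitz matrix `(g_{j-i})`. -/
noncomputable def hankelColumn (u g : R⟦X⟧) (k : ℕ) : R⟦X⟧ :=
  PowerSeries.mk fun i => coeff k (tail i u * g)

theorem coeff_hankelColumn (u g : R⟦X⟧) (k i : ℕ) :
    coeff i (hankelColumn u g k) =
      ∑ p ∈ antidiagonal k, coeff (p.1 + i) u * coeff p.2 g := by
  simp only [hankelColumn, coeff_mk, coeff_mul, coeff_tail]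

theorem hankelColumn_zero (u g : R⟦X⟧) : hankelColumn u g 0 = u * C (coeff 0 g) := by
  ext i
  simp [coeff_hankelColumn]

theorem hankelColumn_succ (u g : R⟦X⟧) (k : ℕ) :
    hankelColumn u g (k + 1) = u * C (coeff (k + 1) g) + hankelColumn (tail 1 u) g k := by
  ext i
  simp [coeff_hankelColumn, Finset.Nat.sum_antidiagonal_succ, coeff_tail, add_right_comm]

theorem hankelColumn_eq_C_add_X_mul (u g : R⟦X⟧) (k : ℕ) :
    hankelColumn u g k = C (coeff k (u * g)) + X * hankelColumn (tail 1 u) g k := by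
  ext i
  cases i with
  | zero => simp [hankelColumn, tail_zero]
  | succ i => simp [hankelColumn, coeff_succ_X_mul, tail_tail]

namespace IsCornerInverse

variable {P : R} {u g : R⟦X⟧}

theorem of_commute_mul {c : R⟦X⟧} (hc : ∀ f, Commute c f) (h : IsCornerInverse P (c * u) g) :
    IsCornerInverse P u (c * g) where
  proj_mul := by rw [← mul_assoc, ← (hc _).eq, mul_assoc, h.proj_mul]
  mul_proj := by rw [mul_assoc, h.mul_proj]
  proj_mul_mul := by rw [mul_assoc, ← mul_assoc u, ← (hc u).eq, ← mul_assoc, h.proj_mul_mul]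
  mul_mul_proj := by rw [(hc g).eq, mul_assoc g, h.mul_mul_proj]

theorem mul_C_coeff (h : IsCornerInverse P u g) (k : ℕ) :
    g * C (coeff k (u * g)) = if k = 0 then g else 0 := by
  rw [← h.mul_proj, mul_assoc, ← map_mul, h.mul_proj, ← coeff_C_mul, ← mul_assoc, h.proj_mul_mul,
    coeff_C]
  split_ifs <;> simp [h.mul_proj]

theorem mul_mul_C_coeff (h : IsCornerInverse P u g) (k : ℕ) :
    g * (u * C (coeff k g)) = C (coeff k g) := by
  rw [← h.proj_mul, coeff_C_mul, map_mul, h.proj_mul, ← mul_assoc u, ← mul_assoc, ← mul_assoc,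
    h.mul_mul_proj]

theorem mul_hankelColumn_zero (h : IsCornerInverse P u g) :
    g * hankelColumn u g 0 = C (coeff 0 g) := by
  rw [hankelColumn_zero, h.mul_mul_C_coeff]

end IsCornerInverse

namespace IsCornerInverse

variable {R : Type*} [Ring R] {P : R} {u g : R⟦X⟧}

theorem mul_hankelColumn_tail (h : IsCornerInverse P u g) (k : ℕ) :
    g * hankelColumn (tail 1 u) g k = -tail (k + 1) g := by
  apply X_mul_cancel
  have hX : X * (g * hankelColumn (tail 1 u) g k) =
      g * hankelColumn u g k - g * C (coeff k (u * g)) := by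
    rw [hankelColumn_eq_C_add_X_mul u, mul_add, add_sub_cancel_left, ← mul_assoc, ← mul_assoc,
      X_mul]
  rw [hX, h.mul_C_coeff, mul_neg, ← sub_eq_iff_eq_add'.mpr (C_coeff_add_X_mul_tail k g).symm]
  cases k with
  | zero => simp [h.mul_hankelColumn_zero, tail_zero]
  | succ k =>
    rw [hankelColumn_succ, mul_add, h.mul_mul_C_coeff, h.mul_hankelColumn_tail k]
    simp [sub_eq_add_neg]

theorem mul_hankelColumn_succ (h : IsCornerInverse P u g) (k : ℕ) :
    g * hankelColumn u g (k + 1) = -(X * tail (k + 2) g) := by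
  rw [hankelColumn_succ, mul_add, h.mul_mul_C_coeff, h.mul_hankelColumn_tail,
    ← C_coeff_add_X_mul_tail (k + 1), neg_add, add_neg_cancel_left]

end IsCornerInverse

end PowerSeries

/-! ### Hankel and Toeplitz matrices over a ring -/

section Toeplitz

open PowerSeries Finset.HasAntidiagonal

variable {R : Type*} [Semiring R] {n : ℕ}

/-- The Hankel matrix `(f_{i+j})` of size `n` over the ring `R`; the blocks of a block Hankel matrix
are the elements of `R`. -/
noncomputable def hankel (n : ℕ) (f : R⟦X⟧) : Matrix (Fin n) (Fin n) R :=
  Matrix.of fun i j => coeff (i + j : ℕ) f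

/-- The lower triangular Toeplitz matrix `(f_{i-j})` of size `n` over `R`: its `j`-th column holds
the coefficients of `X ^ j * f`. -/
noncomputable def toeplitz (n : ℕ) (f : R⟦X⟧) : Matrix (Fin n) (Fin n) R :=
  Matrix.of fun i j => coeff (i : ℕ) (X ^ (j : ℕ) * f)

theorem toeplitz_apply (f : R⟦X⟧) (i j : Fin n) :
    toeplitz n f i j = if j ≤ i then coeff (i - j : ℕ) f else 0 := by
  simp [toeplitz, coeff_X_pow_mul']

theorem sum_ite_le_eq_sum_antidiagonal {M : Type*} [AddCommMonoid M] (F : ℕ → ℕ → M)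
    (i : Fin n) :
    ∑ j : Fin n, (if j ≤ i then F (i - j) j else 0) =
      ∑ p ∈ antidiagonal (i : ℕ), F p.1 p.2 := by
  have hi : (Finset.range n).filter (· ≤ (i : ℕ)) = Finset.range (i + 1) := by
    ext j
    simp only [Finset.mem_filter, Finset.mem_range]
    omega
  simp only [Fin.le_def]
  rw [Fin.sum_univ_eq_sum_range (fun j => if j ≤ (i : ℕ) then F (i - j) j else 0),
    ← Finset.sum_filter, hi, ← Finset.Nat.sum_antidiagonal_swap,
    Finset.Nat.sum_antidiagonal_eq_sum_range_succ_mk]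
  rfl

theorem toeplitz_mul_of_coeff {m : Type*} (g : R⟦X⟧) (c : m → R⟦X⟧) :
    toeplitz n g * Matrix.of (fun (i : Fin n) k => coeff (i : ℕ) (c k)) =
      Matrix.of fun (i : Fin n) k => coeff (i : ℕ) (g * c k) := by
  ext i k
  simp only [Matrix.mul_apply, toeplitz_apply, Matrix.of_apply, coeff_mul, ite_mul, zero_mul]
  exact sum_ite_le_eq_sum_antidiagonal (fun a b => coeff a g * coeff b (c k)) i

theorem of_coeff_mul_toeplitz_transpose {m : Type*} (g : R⟦X⟧) (r : m → R⟦X⟧) :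
    Matrix.of (fun k (j : Fin n) => coeff (j : ℕ) (r k)) * (toeplitz n g)ᵀ =
      Matrix.of fun k (j : Fin n) => coeff (j : ℕ) (r k * g) := by
  ext k j
  rw [Matrix.of_apply, coeff_mul, ← Finset.Nat.sum_antidiagonal_swap]
  simp only [Matrix.mul_apply, Matrix.transpose_apply, toeplitz_apply, Matrix.of_apply, mul_ite,
    mul_zero]
  exact sum_ite_le_eq_sum_antidiagonal (fun a b => coeff b (r k) * coeff a g) j

theorem toeplitz_mul_hankel_mul_toeplitz_transpose (u g : R⟦X⟧) :
    toeplitz n g * hankel n u * (toeplitz n g)ᵀ =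
      Matrix.of fun j k : Fin n => coeff (j : ℕ) (g * hankelColumn u g k) := by
  have h := of_coeff_mul_toeplitz_transpose (n := n) g fun i : Fin n => tail i u
  have h' := toeplitz_mul_of_coeff (n := n) g fun k : Fin n => hankelColumn u g k
  rw [Matrix.mul_assoc, ← h']
  congr 1
  convert h using 2
  · ext i j
    simp [hankel, coeff_tail, add_comm]
  · ext i j
    simp [hankelColumn]

theorem toeplitz_mul (f g : R⟦X⟧) : toeplitz n f * toeplitz n g = toeplitz n (f * g) := by
  refine (toeplitz_mul_of_coeff f fun j : Fin n => X ^ (j : ℕ) * g).trans ?_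
  simp only [toeplitz, X_pow_mul, mul_assoc]

theorem toeplitz_transpose_mul (f g : R⟦X⟧) :
    (toeplitz n f)ᵀ * (toeplitz n g)ᵀ = (toeplitz n (f * g))ᵀ := by
  refine (of_coeff_mul_toeplitz_transpose g fun j : Fin n => X ^ (j : ℕ) * f).trans ?_
  simp only [mul_assoc]
  rfl

theorem toeplitz_C (a : R) : toeplitz n (C a) = Matrix.diagonal fun _ => a := by
  ext i j
  simp [toeplitz, Matrix.diagonal_apply, coeff_X_pow, Fin.val_inj]

namespace IsCornerInverse

variable {R : Type*} [Ring R] {P : R} {u g : R⟦X⟧}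

theorem toeplitz_mul_hankel_tail (h : IsCornerInverse P u g) :
    toeplitz n g * hankel n (tail 1 u) * (toeplitz n g)ᵀ = hankel n (-tail 1 g) := by
  rw [toeplitz_mul_hankel_mul_toeplitz_transpose]
  ext j k
  simp [h.mul_hankelColumn_tail, hankel, coeff_tail, add_assoc]

theorem toeplitz_mul_hankel_apply_succ_succ (h : IsCornerInverse P u g) (j k : Fin n) :
    (toeplitz (n + 1) g * hankel (n + 1) u * (toeplitz (n + 1) g)ᵀ) j.succ k.succ =
      hankel n (-tail 2 g) j k := by
  rw [toeplitz_mul_hankel_mul_toeplitz_transpose]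
  simp [h.mul_hankelColumn_succ, hankel, coeff_succ_X_mul, coeff_tail, add_assoc]

theorem toeplitz_mul_hankel_apply_succ_zero (h : IsCornerInverse P u g) (j : Fin n) :
    (toeplitz (n + 1) g * hankel (n + 1) u * (toeplitz (n + 1) g)ᵀ) j.succ 0 = 0 := by
  simp [toeplitz_mul_hankel_mul_toeplitz_transpose, h.mul_hankelColumn_zero]

theorem isUnit_toeplitz (h : IsCornerInverse 1 u g) : IsUnit (toeplitz n g) := by
  have hgu : g * u = 1 := by simpa using h.mul_mul_proj
  have hug : u * g = 1 := by simpa using h.proj_mul_mul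
  have h1 : toeplitz n (1 : R⟦X⟧) = 1 := by simpa using toeplitz_C (n := n) (1 : R)
  exact isUnit_iff_exists.mpr ⟨toeplitz n u, by rw [toeplitz_mul, hgu, h1],
    by rw [toeplitz_mul, hug, h1]⟩

theorem exists_mulVec_toeplitz_transpose_eq (h : IsCornerInverse P u g) {S : R}
    (hPS : P * S = S) (hS : constantCoeff u * S = P) {V : Fin (n + 1) → R}
    (hV : V (Fin.last n) = 1) :
    ∃ W : Fin (n + 1) → R, W (Fin.last n) = 1 ∧
      (toeplitz (n + 1) g)ᵀ *ᵥ W = fun i => P * (V i * S) := by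
  -- Since `g * (1 - P) = 0`, adding `1 - P` to the last entry of the preimage is harmless.
  refine ⟨(toeplitz (n + 1) (u * C P))ᵀ *ᵥ (fun i => V i * S) + Pi.single (Fin.last n) (1 - P),
    ?_, ?_⟩
  · simp [Matrix.mulVec, dotProduct, toeplitz_apply, Fin.last_le_iff, hV, mul_assoc, hPS, hS]
  · have hg (k : ℕ) : coeff k g * (1 - P) = 0 := by
      rw [mul_sub, mul_one, ← coeff_mul_C, h.mul_proj, sub_self]
    rw [Matrix.mulVec_add, Matrix.mulVec_mulVec, toeplitz_transpose_mul, ← mul_assoc,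
      h.mul_mul_proj, toeplitz_C, Matrix.diagonal_transpose]
    ext i
    simp [toeplitz_apply, hg]

theorem exists_toeplitz_mul_hankel_mulVec_eq_zero (h : IsCornerInverse P u g) {S : R}
    (hPS : P * S = S) (hS : constantCoeff u * S = P) {x : R⟦X⟧}
    (hx : ∀ j < 2 * n, coeff j x * P = coeff j x)
    (hker : ∃ V : Fin (n + 1) → R, V (Fin.last n) = 1 ∧ hankel (n + 1) x *ᵥ V = 0) :
    ∃ W : Fin (n + 1) → R, W (Fin.last n) = 1 ∧
      (toeplitz (n + 1) g * hankel (n + 1) x * (toeplitz (n + 1) g)ᵀ) *ᵥ W = 0 := by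
  obtain ⟨V, hV, hker⟩ := hker
  obtain ⟨W, hW, hgW⟩ := h.exists_mulVec_toeplitz_transpose_eq hPS hS hV
  have hxV : hankel (n + 1) x *ᵥ (fun i => P * (V i * S)) = 0 := by
    ext i
    have hi : ∑ j : Fin (n + 1), coeff (i + j : ℕ) x * V j = 0 := congrFun hker i
    have hP (j : Fin (n + 1)) :
        coeff (i + j : ℕ) x * (P * (V j * S)) = coeff (i + j : ℕ) x * V j * S := by
      rcases j.le_last.eq_or_lt with rfl | hj
      · rw [hV, one_mul, hPS, mul_one]
      · rw [← mul_assoc, hx _ (by rw [Fin.lt_def, Fin.val_last] at hj; omega), mul_assoc]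
    simp only [Matrix.mulVec, dotProduct, hankel, Matrix.of_apply, hP]
    rw [← Finset.sum_mul, hi, zero_mul, Pi.zero_apply]
  refine ⟨W, hW, ?_⟩
  rw [← Matrix.mulVec_mulVec, hgW, ← Matrix.mulVec_mulVec, hxV, Matrix.mulVec_zero]

end IsCornerInverse

end Toeplitz

/-! ### Reciprocal sequences as corner inverses -/

section Reciprocal

open PowerSeries

theorem left_inv_eq_right_inv_of_corner {M : Type*} [Monoid M] {e f u g k : M}
    (hg : f * g = g) (hug : e * u * g = e) (hk : k * e = k) (hku : k * u * f = f) : k = g :=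
  calc
    k = k * (e * u * g) := by rw [hug, hk]
    _ = k * u * f * g := by rw [mul_assoc (k * u), hg, ← mul_assoc, ← mul_assoc, hk]
    _ = g := by rw [hku, hg]

section Star

variable {R : Type*} [Semiring R] [StarRing R]

/-- The power series whose coefficients are the adjoints of those of `f`. -/
noncomputable def starSeries (f : R⟦X⟧) : R⟦X⟧ := PowerSeries.mk fun i => star (coeff i f)

theorem starSeries_mul (f g : R⟦X⟧) : starSeries (f * g) = starSeries g * starSeries f := by
  ext i
  simp only [starSeries, coeff_mk, coeff_mul, star_sum, star_mul]
  exact Finset.Nat.sum_antidiagonal_swap (f := fun p => star (coeff p.1 g) * star (coeff p.2 f))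

theorem starSeries_C (a : R) : starSeries (C a) = C (star a) := by
  ext i
  simp only [starSeries, coeff_mk, coeff_C]
  split_ifs <;> simp

end Star

variable {u : ℕ → Matrix (Fin q) (Fin q) ℂ}

theorem C_mul_mk_recipSeq (u : ℕ → Matrix (Fin q) (Fin q) ℂ) :
    C (pinv (u 0) * u 0) * mk (recipSeq u) = mk (recipSeq u) := by
  have hMP := (isMoorePenrose_pinv (u 0)).mul_mul_right
  ext1 j
  rw [coeff_C_mul, coeff_mk]
  cases j with
  | zero => rw [recipSeq, hMP]
  | succ j => rw [recipSeq, mul_neg, ← mul_assoc, hMP]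

theorem C_mul_mk_mul_mk_recipSeq (u : ℕ → Matrix (Fin q) (Fin q) ℂ) :
    C (u 0 * pinv (u 0)) * mk u * mk (recipSeq u) = C (u 0 * pinv (u 0)) := by
  have hMP := (isMoorePenrose_pinv (u 0)).mul_mul_left
  ext1 j
  rw [mul_assoc, coeff_C_mul, coeff_mul]
  cases j with
  | zero => simp [recipSeq, ← mul_assoc, hMP]
  | succ j =>
    rw [← Finset.Nat.sum_antidiagonal_swap, Finset.Nat.sum_antidiagonal_eq_sum_range_succ_mk,
      Finset.sum_range_succ, Finset.sum_range]
    simp [recipSeq, mul_add, ← mul_assoc, hMP]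

theorem starSeries_mk_recipSeq_mul_C (u : ℕ → Matrix (Fin q) (Fin q) ℂ) :
    starSeries (mk (recipSeq fun j => (u j)ᴴ)) * C (u 0 * pinv (u 0)) =
      starSeries (mk (recipSeq fun j => (u j)ᴴ)) := by
  have hMP := (isMoorePenrose_pinv (u 0)).isHermitian_left
  have h := congrArg starSeries (C_mul_mk_recipSeq fun j => (u j)ᴴ)
  rwa [starSeries_mul, starSeries_C, pinv_conjTranspose, ← Matrix.conjTranspose_mul, hMP,
    Matrix.star_eq_conjTranspose, hMP] at h

theorem starSeries_mk_recipSeq_mul_mk_mul_C (u : ℕ → Matrix (Fin q) (Fin q) ℂ) :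
    starSeries (mk (recipSeq fun j => (u j)ᴴ)) * mk u * C (pinv (u 0) * u 0) =
      C (pinv (u 0) * u 0) := by
  have hMP := (isMoorePenrose_pinv (u 0)).isHermitian_right
  have hu : starSeries (mk fun j => (u j)ᴴ) = mk u := by
    ext1 j
    simp [starSeries, Matrix.star_eq_conjTranspose]
  have h := congrArg starSeries (C_mul_mk_mul_mk_recipSeq fun j => (u j)ᴴ)
  rwa [starSeries_mul, starSeries_mul, starSeries_C, pinv_conjTranspose,
    ← Matrix.conjTranspose_mul, hMP, Matrix.star_eq_conjTranspose, hMP, hu, ← mul_assoc] at h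

/- The recursion makes `recipSeq u` a right inverse of `u` in the corner, and the adjoint of the
recursion for `uᴴ` provides a left inverse. -/
theorem starSeries_mk_recipSeq (u : ℕ → Matrix (Fin q) (Fin q) ℂ) :
    starSeries (mk (recipSeq fun j => (u j)ᴴ)) = mk (recipSeq u) :=
  left_inv_eq_right_inv_of_corner (C_mul_mk_recipSeq u) (C_mul_mk_mul_mk_recipSeq u)
    (starSeries_mk_recipSeq_mul_C u) (starSeries_mk_recipSeq_mul_mk_mul_C u)

theorem recipSeq_conjTranspose (u : ℕ → Matrix (Fin q) (Fin q) ℂ) (j : ℕ) :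
    recipSeq (fun i => (u i)ᴴ) j = (recipSeq u j)ᴴ := by
  rw [← Matrix.conjTranspose_inj, Matrix.conjTranspose_conjTranspose]
  simpa [starSeries, Matrix.star_eq_conjTranspose] using
    congrArg (coeff j) (starSeries_mk_recipSeq u)

theorem isCornerInverse_recipSeq (hu : Commute (u 0) (pinv (u 0))) :
    IsCornerInverse (u 0 * pinv (u 0)) (mk u) (mk (recipSeq u)) where
  proj_mul := by rw [hu.eq, C_mul_mk_recipSeq]
  mul_proj := by rw [← starSeries_mk_recipSeq, starSeries_mk_recipSeq_mul_C]
  proj_mul_mul := C_mul_mk_mul_mk_recipSeq u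
  mul_mul_proj := by
    rw [← starSeries_mk_recipSeq, hu.eq, starSeries_mk_recipSeq_mul_mk_mul_C]

theorem isHermitian_recipSeq {j : ℕ} (hu : ∀ i ≤ j, (u i).IsHermitian) :
    (recipSeq u j).IsHermitian := by
  rw [Matrix.IsHermitian, ← recipSeq_conjTranspose]
  exact recipSeq_congr hu le_rfl

end Reciprocal

/-! ### Block Hankel matrices -/

section Block

open PowerSeries

variable {s t : ℕ → Matrix (Fin q) (Fin q) ℂ} {m n : ℕ}

/-- The lower triangular block Toeplitz matrix with first block column `(s_0, …, s_n)`. -/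
noncomputable def blockToeplitz (s : ℕ → Matrix (Fin q) (Fin q) ℂ) (n : ℕ) :
    Matrix (Fin (n + 1) × Fin q) (Fin (n + 1) × Fin q) ℂ :=
  Matrix.comp _ _ _ _ _ (toeplitz (n + 1) (mk s))

/-- The block column with blocks `V i`. -/
def blockColumn {ι : Type*} (V : ι → Matrix (Fin q) (Fin q) ℂ) :
    Matrix (ι × Fin q) (Fin q) ℂ :=
  Matrix.of fun a b => V a.1 a.2 b

theorem blockColumn_eq_zero_iff {ι : Type*} {V : ι → Matrix (Fin q) (Fin q) ℂ} :
    blockColumn V = 0 ↔ V = 0 := by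
  simp only [← Matrix.ext_iff, funext_iff, Prod.forall]
  rfl

theorem blockHankel_eq_comp (s : ℕ → Matrix (Fin q) (Fin q) ℂ) (n : ℕ) :
    blockHankel s n = Matrix.comp _ _ _ _ _ (hankel (n + 1) (mk s)) := by
  ext a b
  simp [blockHankel, hankel]

theorem comp_mul {ι : Type*} [Fintype ι] (M N : Matrix ι ι (Matrix (Fin q) (Fin q) ℂ)) :
    Matrix.comp _ _ _ _ _ (M * N) = Matrix.comp _ _ _ _ _ M * Matrix.comp _ _ _ _ _ N :=
  map_mul (Matrix.compRingEquiv ι (Fin q) ℂ) M N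

theorem conjTranspose_blockToeplitz (hs : ∀ j ≤ n, (s j).IsHermitian) :
    (blockToeplitz s n)ᴴ = Matrix.comp _ _ _ _ _ (toeplitz (n + 1) (mk s))ᵀ := by
  ext a b
  simp only [blockToeplitz, Matrix.conjTranspose_apply, Matrix.comp_apply,
    Matrix.transpose_apply, toeplitz_apply]
  split_ifs
  · rw [coeff_mk, (hs _ (by omega)).apply]
  · simp

theorem blockHankel_submatrix (s : ℕ → Matrix (Fin q) (Fin q) ℂ) (h : m ≤ n) :
    (blockHankel s n).submatrix (Prod.map (Fin.castLE (by omega)) id)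
      (Prod.map (Fin.castLE (by omega)) id) = blockHankel s m := rfl

theorem posSemidef_blockHankel_mono (h : m ≤ n) (hs : (blockHankel s n).PosSemidef) :
    (blockHankel s m).PosSemidef :=
  blockHankel_submatrix s h ▸ hs.submatrix _

theorem posDef_blockHankel_mono (h : m ≤ n) (hs : (blockHankel s n).PosDef) :
    (blockHankel s m).PosDef :=
  blockHankel_submatrix s h ▸ hs.submatrix
    ((Fin.castLE_injective _).prodMap Function.injective_id)

theorem isHermitian_of_posSemidef_blockHankel (hs : (blockHankel s n).PosSemidef) {j : ℕ}
    (hj : j ≤ 2 * n) : (s j).IsHermitian := by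
  ext a b
  have h := hs.isHermitian.apply (⟨j / 2, by omega⟩, a) (⟨j - j / 2, by omega⟩, b)
  simp only [blockHankel, Matrix.of_apply] at h
  rwa [Nat.sub_add_cancel (Nat.div_le_self j 2), Nat.add_sub_cancel' (Nat.div_le_self j 2)] at h

theorem mul_eq_zero_of_posSemidef_blockHankel {Q : Matrix (Fin q) (Fin q) ℂ}
    (hs : (blockHankel s (n + 1)).PosSemidef) (hQ : s (2 * n) * Q = 0) :
    s (2 * n + 1) * Q = 0 := by
  have h : (Matrix.fromBlocks (s (2 * n)) (s (2 * n + 1)) (s (2 * n + 1))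
      (s (2 * n + 2))).PosSemidef := by
    convert hs.submatrix (Sum.elim (Prod.mk (Fin.last n).castSucc) (Prod.mk (Fin.last (n + 1))))
    ext (a | a) (b | b) <;> simp [blockHankel] <;> congr 1 <;> ring
  exact mul_eq_zero_of_posSemidef_fromBlocks h hQ

theorem fromBlocks_blockHankel (s : ℕ → Matrix (Fin q) (Fin q) ℂ) (n : ℕ) :
    Matrix.fromBlocks (blockHankel s n) (blockCol s (n + 1) n) (blockRow s (n + 1) n)
        (s (2 * (n + 1))) =
      (blockHankel s (n + 1)).submatrix
        (Sum.elim (Prod.map Fin.castSucc id) (Prod.mk (Fin.last (n + 1))))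
        (Sum.elim (Prod.map Fin.castSucc id) (Prod.mk (Fin.last (n + 1)))) := by
  ext (a | a) (b | b) <;>
    simp [blockHankel, blockCol, blockRow, two_mul, add_comm]

theorem hankel_mulVec_snoc (s : ℕ → Matrix (Fin q) (Fin q) ℂ)
    (V : Fin (n + 1) → Matrix (Fin q) (Fin q) ℂ) (i : Fin (n + 2)) :
    (hankel (n + 2) (mk s) *ᵥ Fin.snoc (α := fun _ => Matrix (Fin q) (Fin q) ℂ) V 1) i =
      ∑ j : Fin (n + 1), s (i + j) * V j + s (i + (n + 1)) := by
  simp [Matrix.mulVec, dotProduct, hankel, Fin.sum_univ_castSucc]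

theorem hankel_mulVec_snoc_eq_zero_iff (s : ℕ → Matrix (Fin q) (Fin q) ℂ)
    (V : Fin (n + 1) → Matrix (Fin q) (Fin q) ℂ) :
    hankel (n + 2) (mk s) *ᵥ Fin.snoc (α := fun _ => Matrix (Fin q) (Fin q) ℂ) V 1 = 0 ↔
      blockHankel s n * blockColumn V + blockCol s (n + 1) n = 0 ∧
        blockRow s (n + 1) n * blockColumn V + s (2 * (n + 1)) = 0 := by
  have hHankel : blockHankel s n * blockColumn V + blockCol s (n + 1) n =
      blockColumn fun i : Fin (n + 1) => ∑ j : Fin (n + 1), s (i + j) * V j + s (i + (n + 1)) := by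
    ext a b
    simp [blockHankel, blockColumn, blockCol, Matrix.mul_apply, Fintype.sum_prod_type,
      Matrix.sum_apply, add_comm]
  have hRow : blockRow s (n + 1) n * blockColumn V + s (2 * (n + 1)) =
      ∑ j : Fin (n + 1), s (n + 1 + j) * V j + s (n + 1 + (n + 1)) := by
    ext a b
    simp [blockRow, blockColumn, Matrix.mul_apply, Fintype.sum_prod_type, Matrix.sum_apply,
      two_mul]
  rw [hHankel, hRow, blockColumn_eq_zero_iff, funext_iff, Fin.forall_fin_succ']
  simp [hankel_mulVec_snoc, funext_iff]

theorem schurL_eq_zero_iff (hs : (blockHankel s n).PosSemidef) :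
    schurL s n = 0 ↔ ∃ V : Fin (n + 1) → Matrix (Fin q) (Fin q) ℂ,
      V (Fin.last n) = 1 ∧ hankel (n + 1) (mk s) *ᵥ V = 0 := by
  cases n with
  | zero =>
    have hker (V : Fin 1 → Matrix (Fin q) (Fin q) ℂ) :
        hankel 1 (mk s) *ᵥ V = 0 ↔ s 0 * V 0 = 0 := by
      simp [Matrix.mulVec, dotProduct, hankel, funext_iff]
    refine ⟨fun h => ⟨1, rfl, (hker 1).mpr ?_⟩, fun ⟨V, hV, h⟩ => ?_⟩
    · rw [show s 0 = 0 from h, zero_mul]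
    · rwa [hker, show V 0 = 1 from hV, mul_one] at h
  | succ n =>
    have h := fromBlocks_blockHankel s n ▸ hs.submatrix _
    rw [schurL, schur_complement_eq_zero_iff h]
    constructor
    · rintro ⟨X, hX⟩
      exact ⟨_, Fin.snoc_last _ _, (hankel_mulVec_snoc_eq_zero_iff s
        fun i => Matrix.of fun a b => X (i, a) b).mpr hX⟩
    · rintro ⟨V, hV, hker⟩
      refine ⟨blockColumn (Fin.init V), (hankel_mulVec_snoc_eq_zero_iff s _).mp ?_⟩
      rwa [← hV, Fin.snoc_init_self]

end Block

/-! ### The transform of Hankel non-negative definite sequences -/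

section Transform

open PowerSeries

variable {α : ℝ} {s t : ℕ → Matrix (Fin q) (Fin q) ℂ} {m n : ℕ}

theorem mk_plusSeq (α : ℂ) (s : ℕ → Matrix (Fin q) (Fin q) ℂ) :
    mk (plusSeq α s) = (1 - α • X) * mk s := by
  ext1 j
  rw [sub_mul, one_mul, smul_mul_assoc]
  cases j with
  | zero => simp [plusSeq]
  | succ j => simp [plusSeq, coeff_succ_X_mul, sub_eq_neg_add]

theorem commute_one_sub_smul_X (α : ℂ) (f : (Matrix (Fin q) (Fin q) ℂ)⟦X⟧) :
    Commute (1 - α • X) f :=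
  (Commute.one_left f).sub_left ((commute_X f).symm.smul_left α)

theorem tail_one_mk_plusSeq (α : ℂ) (s : ℕ → Matrix (Fin q) (Fin q) ℂ) :
    tail 1 (mk (plusSeq α s)) = mk (shiftSeq α s) := by
  ext1 j
  rw [coeff_tail, coeff_mk, coeff_mk, plusSeq, shiftSeq]

theorem neg_tail_one_mk_recipSeq (α : ℂ) (s : ℕ → Matrix (Fin q) (Fin q) ℂ) :
    -tail 1 (mk (recipSeq (plusSeq α s))) = mk (shortNegRecip α s) := by
  ext1 j
  rw [map_neg, coeff_tail, coeff_mk, coeff_mk, shortNegRecip]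

theorem neg_tail_two_mk_plusSeq_recipSeq (α : ℂ) (s : ℕ → Matrix (Fin q) (Fin q) ℂ) :
    -tail 2 (mk (plusSeq α (recipSeq (plusSeq α s)))) = mk (shiftSeq α (shortNegRecip α s)) := by
  ext1 j
  simp [coeff_tail, plusSeq, shiftSeq, shortNegRecip, add_comm]

theorem isCornerInverse_recipSeq_plusSeq (α : ℂ) (hs : (s 0).IsHermitian) :
    IsCornerInverse (s 0 * pinv (s 0)) (mk (plusSeq α s)) (mk (recipSeq (plusSeq α s))) :=
  isCornerInverse_recipSeq (u := plusSeq α s) (commute_pinv_of_isHermitian hs)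

theorem isCornerInverse_plusSeq_recipSeq_plusSeq (α : ℂ) (hs : (s 0).IsHermitian) :
    IsCornerInverse (s 0 * pinv (s 0)) (mk s) (mk (plusSeq α (recipSeq (plusSeq α s)))) := by
  rw [mk_plusSeq]
  refine .of_commute_mul (commute_one_sub_smul_X α) ?_
  rw [← mk_plusSeq]
  exact isCornerInverse_recipSeq_plusSeq α hs

theorem isHermitian_plusSeq {j : ℕ} (hs : ∀ i ≤ j, (s i).IsHermitian) :
    (plusSeq (α : ℂ) s j).IsHermitian := by
  cases j with
  | zero => exact hs 0 le_rfl
  | succ j => simp [plusSeq, Matrix.IsHermitian, (hs j _).eq, (hs (j + 1) _).eq]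

theorem isHermitian_recipSeq_plusSeq {j : ℕ} (hs : ∀ i ≤ j, (s i).IsHermitian) :
    (recipSeq (plusSeq (α : ℂ) s) j).IsHermitian :=
  isHermitian_recipSeq fun _ hi => isHermitian_plusSeq fun _ hk => hs _ (hk.trans hi)

theorem blockHankel_shortNegRecip (hs : ∀ j ≤ n, (s j).IsHermitian) :
    blockHankel (shortNegRecip (α : ℂ) s) n =
      blockToeplitz (recipSeq (plusSeq (α : ℂ) s)) n * blockHankel (shiftSeq (α : ℂ) s) n *
        (blockToeplitz (recipSeq (plusSeq (α : ℂ) s)) n)ᴴ := by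
  have h := isCornerInverse_recipSeq_plusSeq (α : ℂ) (hs 0 n.zero_le)
  rw [conjTranspose_blockToeplitz fun j hj =>
    isHermitian_recipSeq_plusSeq fun i hi => hs i (hi.trans hj)]
  simp only [blockToeplitz, blockHankel_eq_comp, ← comp_mul]
  rw [← tail_one_mk_plusSeq, h.toeplitz_mul_hankel_tail, neg_tail_one_mk_recipSeq]

theorem blockHankel_shiftSeq_shortNegRecip (hs : ∀ j ≤ n + 1, (s j).IsHermitian) :
    blockHankel (shiftSeq (α : ℂ) (shortNegRecip (α : ℂ) s)) n =
      (blockToeplitz (plusSeq (α : ℂ) (recipSeq (plusSeq (α : ℂ) s))) (n + 1) *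
          blockHankel s (n + 1) *
        (blockToeplitz (plusSeq (α : ℂ) (recipSeq (plusSeq (α : ℂ) s))) (n + 1))ᴴ).submatrix
        (Prod.map Fin.succ id) (Prod.map Fin.succ id) := by
  have h := isCornerInverse_plusSeq_recipSeq_plusSeq (α : ℂ) (hs 0 (Nat.zero_le _))
  rw [conjTranspose_blockToeplitz fun j hj => isHermitian_plusSeq fun i hi =>
    isHermitian_recipSeq_plusSeq fun k hk => hs k (hk.trans (hi.trans hj))]
  simp only [blockToeplitz, blockHankel_eq_comp, ← comp_mul]
  ext a b
  simp only [Matrix.submatrix_apply, Matrix.comp_apply, Prod.map_fst, Prod.map_snd, id,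
    h.toeplitz_mul_hankel_apply_succ_succ, neg_tail_two_mk_plusSeq_recipSeq]

theorem KGeFin.congr (hs : KGeFin α m s) (h : ∀ j ≤ m, s j = t j) : KGeFin α m t := by
  refine ⟨?_, fun hm => ?_⟩
  · rw [← blockHankel_congr fun j hj => h j (by omega)]
    exact hs.1
  · rw [← blockHankel_congr fun j hj =>
      shiftSeq_congr (m := m - 1) _ (fun i hi => h i (by omega)) (by omega)]
    exact hs.2 hm

theorem KGeFin.isHermitian (hs : KGeFin α m s) {j : ℕ} (hj : j ≤ m) : (s j).IsHermitian := by
  by_cases h : j ≤ 2 * (m / 2)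
  · exact isHermitian_of_posSemidef_blockHankel hs.1 h
  · obtain ⟨k, rfl⟩ : ∃ k, j = k + 1 := ⟨j - 1, by omega⟩
    have hk := isHermitian_of_posSemidef_blockHankel hs.1 (j := k) (by omega)
    have hshift := isHermitian_of_posSemidef_blockHankel (hs.2 (by omega)) (j := k) (by omega)
    simpa [Matrix.IsHermitian, shiftSeq, hk.eq] using hshift

theorem KGeFin.mul_eq_zero {Q : Matrix (Fin q) (Fin q) ℂ} (hs : KGeFin α (m + 1) s)
    (hQ : s 0 * Q = 0) {j : ℕ} (hj : j ≤ m) : s j * Q = 0 := by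
  have hshift (i : ℕ) (hi : s i * Q = 0) : shiftSeq (α : ℂ) s i * Q = s (i + 1) * Q := by
    rw [shiftSeq, add_mul, neg_mul, smul_mul_assoc, hi, smul_zero, neg_zero, zero_add]
  induction j using Nat.strong_induction_on with
  | _ j ih =>
    obtain rfl | ⟨k, rfl | rfl⟩ : j = 0 ∨ ∃ k, j = 2 * k + 1 ∨ j = 2 * k + 2 := by
      rcases j.eq_zero_or_pos with rfl | hpos
      · exact .inl rfl
      · exact .inr ⟨(j - 1) / 2, by omega⟩
    · exact hQ
    · exact mul_eq_zero_of_posSemidef_blockHankel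
        (posSemidef_blockHankel_mono (by omega) hs.1) (ih (2 * k) (by omega) (by omega))
    · have h1 := ih (2 * k + 1) (by omega) (by omega)
      rw [← hshift _ h1]
      refine mul_eq_zero_of_posSemidef_blockHankel
        (posSemidef_blockHankel_mono (by omega) (hs.2 (by omega))) ?_
      rw [hshift _ (ih (2 * k) (by omega) (by omega)), h1]

theorem KGeFin.mul_proj (hs : KGeFin α (m + 1) s) {j : ℕ} (hj : j ≤ m) :
    s j * (s 0 * pinv (s 0)) = s j := by
  have h0 : s 0 * (1 - s 0 * pinv (s 0)) = 0 := by
    rw [(commute_pinv_of_isHermitian (hs.isHermitian (Nat.zero_le _))).eq, mul_sub, mul_one,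
      ← mul_assoc, (isMoorePenrose_pinv (s 0)).mul_mul_left, sub_self]
  have h := hs.mul_eq_zero h0 hj
  rwa [mul_sub, mul_one, sub_eq_zero, eq_comm] at h

protected theorem KGeFin.shortNegRecip (hs : KGeFin α (m + 1) s) :
    KGeFin α m (shortNegRecip (α : ℂ) s) := by
  refine ⟨?_, fun hm => ?_⟩
  · rw [blockHankel_shortNegRecip fun j hj => hs.isHermitian (by omega)]
    exact (hs.2 (by omega)).mul_mul_conjTranspose_same _
  · rw [blockHankel_shiftSeq_shortNegRecip fun j hj => hs.isHermitian (by omega)]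
    exact ((posSemidef_blockHankel_mono (by omega) hs.1).mul_mul_conjTranspose_same _).submatrix _

theorem KGtFin.kGeFin (hs : KGtFin α m s) : KGeFin α m s :=
  ⟨hs.1.posSemidef, fun hm => (hs.2 hm).posSemidef⟩

theorem KGtFin.mul_pinv_eq_one (hs : KGtFin α m s) : s 0 * pinv (s 0) = 1 := by
  have h0 : (s 0).PosDef := (posDef_blockHankel_mono (Nat.zero_le _) hs.1).submatrix
    (e := Prod.mk (0 : Fin 1)) (Prod.mk_right_injective 0)
  exact mul_pinv_of_isUnit h0.isUnit

theorem posDef_blockToeplitz_mul_mul {u : (Matrix (Fin q) (Fin q) ℂ)⟦X⟧}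
    (h : IsCornerInverse 1 u (mk t)) (hs : (blockHankel s n).PosDef) :
    (blockToeplitz t n * blockHankel s n * (blockToeplitz t n)ᴴ).PosDef :=
  (Matrix.IsUnit.posDef_star_right_conjugate_iff
    (h.isUnit_toeplitz.map (Matrix.compRingEquiv (Fin (n + 1)) (Fin q) ℂ))).mpr hs

protected theorem KGtFin.shortNegRecip (hs : KGtFin α (m + 1) s) :
    KGtFin α m (shortNegRecip (α : ℂ) s) := by
  have hherm {j : ℕ} (hj : j ≤ m + 1) : (s j).IsHermitian := hs.kGeFin.isHermitian hj
  have hplus := isCornerInverse_recipSeq_plusSeq (α : ℂ) (hherm (Nat.zero_le _))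
  have hself := isCornerInverse_plusSeq_recipSeq_plusSeq (α : ℂ) (hherm (Nat.zero_le _))
  rw [hs.mul_pinv_eq_one] at hplus hself
  refine ⟨?_, fun hm => ?_⟩
  · rw [blockHankel_shortNegRecip fun j hj => hherm (by omega)]
    exact posDef_blockToeplitz_mul_mul hplus (hs.2 (by omega))
  · rw [blockHankel_shiftSeq_shortNegRecip fun j hj => hherm (by omega)]
    exact (posDef_blockToeplitz_mul_mul hself (posDef_blockHankel_mono (by omega) hs.1)).submatrix
      ((Fin.succ_injective _).prodMap Function.injective_id)

theorem KGeFin.schurL_shortNegRecip_eq_zero (hs : KGeFin α (2 * n + 1) s)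
    (hL : schurL (shiftSeq (α : ℂ) s) n = 0) :
    schurL (shortNegRecip (α : ℂ) s) n = 0 := by
  have h0 : (s 0).IsHermitian := hs.isHermitian (Nat.zero_le _)
  have h := isCornerInverse_recipSeq_plusSeq (α : ℂ) h0
  rw [schurL_eq_zero_iff (posSemidef_blockHankel_mono (m := n) (by omega) (hs.2 (by omega)))] at hL
  rw [schurL_eq_zero_iff (posSemidef_blockHankel_mono (m := n) (by omega) hs.shortNegRecip.1),
    ← neg_tail_one_mk_recipSeq, ← h.toeplitz_mul_hankel_tail, tail_one_mk_plusSeq]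
  refine h.exists_toeplitz_mul_hankel_mulVec_eq_zero (mul_pinv_mul_pinv h0) rfl
    (fun j hj => ?_) hL
  rw [coeff_mk, shiftSeq, add_mul, neg_mul, smul_mul_assoc, hs.mul_proj (j := j) (by omega),
    hs.mul_proj (j := j + 1) (by omega)]

theorem KGeFin.schurL_shiftSeq_shortNegRecip_eq_zero (hs : KGeFin α (2 * n + 2) s)
    (hL : schurL s (n + 1) = 0) :
    schurL (shiftSeq (α : ℂ) (shortNegRecip (α : ℂ) s)) n = 0 := by
  have h0 : (s 0).IsHermitian := hs.isHermitian (Nat.zero_le _)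
  have h := isCornerInverse_plusSeq_recipSeq_plusSeq (α : ℂ) h0
  rw [schurL_eq_zero_iff (posSemidef_blockHankel_mono (m := n + 1) (by omega) hs.1)] at hL
  rw [schurL_eq_zero_iff
    (posSemidef_blockHankel_mono (m := n) (by omega) (hs.shortNegRecip.2 (by omega)))]
  obtain ⟨W, hW, hker⟩ := h.exists_toeplitz_mul_hankel_mulVec_eq_zero (mul_pinv_mul_pinv h0) rfl
    (fun j hj => by rw [coeff_mk, hs.mul_proj (j := j) (by omega)]) hL
  refine ⟨W ∘ Fin.succ, hW, ?_⟩
  ext1 i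
  have hi := congrFun hker i.succ
  rw [Matrix.mulVec, dotProduct, Fin.sum_univ_succ, h.toeplitz_mul_hankel_apply_succ_zero,
    zero_mul, zero_add] at hi
  simp only [h.toeplitz_mul_hankel_apply_succ_succ, neg_tail_two_mk_plusSeq_recipSeq] at hi
  exact hi

protected theorem KCDFin.shortNegRecip (hs : KCDFin α (m + 1) s) :
    KCDFin α m (shortNegRecip (α : ℂ) s) := by
  have ht := hs.1.shortNegRecip
  obtain ⟨n, rfl | rfl⟩ := m.even_or_odd'
  · have hCD := (hs.2.2 (odd_two_mul_add_one n)).2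
    refine ⟨ht, fun _ => ⟨ht.1, ?_⟩, fun h => absurd (even_two_mul n) (Nat.not_even_iff_odd.mpr h)⟩
    rw [show (2 * n + 1) / 2 = n by omega] at hCD
    rw [show 2 * n / 2 = n by omega]
    exact hs.1.schurL_shortNegRecip_eq_zero hCD
  · have hCD := (hs.2.1 ⟨n + 1, by ring⟩).2
    refine ⟨ht, fun h => absurd (odd_two_mul_add_one n) (Nat.not_odd_iff_even.mpr h), fun _ => ?_⟩
    rw [show (2 * n + 1 + 1) / 2 = n + 1 by omega] at hCD
    rw [show (2 * n + 1) / 2 = n by omega]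
    have hH := ht.2 (by omega)
    rw [show (2 * n + 1 - 1) / 2 = n by omega] at hH
    exact ⟨hH, hs.1.schurL_shiftSeq_shortNegRecip_eq_zero hCD⟩

theorem KCDFin.shortNegRecip_zero (hs : KCDFin α 0 s) :
    KCDFin α 0 (shortNegRecip (α : ℂ) s) := by
  have h0 : plusSeq (α : ℂ) s 0 = 0 := (hs.2.1 .zero).2
  have ht : shortNegRecip (α : ℂ) s = 0 := by
    funext j
    rw [shortNegRecip, recipSeq_eq_zero h0, neg_zero, Pi.zero_apply]
  have hH : (blockHankel (0 : ℕ → Matrix (Fin q) (Fin q) ℂ) 0).PosSemidef :=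
    Matrix.PosSemidef.zero
  rw [ht]
  exact ⟨⟨hH, by simp⟩, fun _ => ⟨hH, rfl⟩, by simp⟩

theorem KCDFin.shortNegRecip_pred (hs : KCDFin α m s) :
    KCDFin α (m - 1) (shortNegRecip (α : ℂ) s) := by
  cases m with
  | zero => exact hs.shortNegRecip_zero
  | succ m => exact hs.shortNegRecip

variable {κ : ℕ∞}

protected theorem KGe.shortNegRecip (hs : KGe α (κ + 1) s) : KGe α κ (shortNegRecip (α : ℂ) s) :=
  match κ with
  | ⊤ => fun m => (hs (m + 1)).shortNegRecip
  | (_ : ℕ) => KGeFin.shortNegRecip hs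

protected theorem KGt.shortNegRecip (hs : KGt α (κ + 1) s) : KGt α κ (shortNegRecip (α : ℂ) s) :=
  match κ with
  | ⊤ => fun m => (hs (m + 1)).shortNegRecip
  | (_ : ℕ) => KGtFin.shortNegRecip hs

protected theorem KGeExt.shortNegRecip (hs : KGeExt α (κ + 1) s) :
    KGeExt α κ (shortNegRecip (α : ℂ) s) := by
  cases κ with
  | top => exact KGe.shortNegRecip (κ := ⊤) hs
  | coe m =>
    obtain ⟨A, hA⟩ := hs
    refine ⟨shortNegRecip (α : ℂ) (Function.update s (m + 2) A) (m + 1),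
      (KGeFin.shortNegRecip hA).congr fun j hj => ?_⟩
    rcases hj.eq_or_lt with rfl | hlt
    · rw [Function.update_self]
    · rw [Function.update_of_ne hlt.ne]
      refine shortNegRecip_congr (m := m) _ (fun i hi => ?_) (Nat.lt_succ_iff.mp hlt)
      exact Function.update_of_ne (show i ≠ m + 2 by omega) _ _

protected theorem KCDAt.shortNegRecip (hs : KCDAt α m (κ + 1) s) :
    KCDAt α (m - 1) κ (shortNegRecip (α : ℂ) s) :=
  ⟨hs.1.shortNegRecip, hs.2.shortNegRecip_pred⟩

protected theorem KCD.shortNegRecip (hs : KCD α (κ + 1) s) : KCD α κ (shortNegRecip (α : ℂ) s) :=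
  match κ with
  | ⊤ => ⟨KGe.shortNegRecip (κ := ⊤) hs.1, hs.2.elim fun m hm => ⟨m - 1, hm.shortNegRecip_pred⟩⟩
  | (_ : ℕ) => KCDFin.shortNegRecip hs

end Transform

end StieltjesSeq

open StieltjesSeq in
theorem propositionP1542 (q : ℕ) (hq : 1 ≤ q) (α : ℝ) (κ : ℕ∞) (hκ : 1 ≤ κ)
    (s : ℕ → Matrix (Fin q) (Fin q) ℂ) :
    (KGe α κ s → KGe α (κ - 1) (shortNegRecip (α : ℂ) s)) ∧
    (KGeExt α κ s → KGeExt α (κ - 1) (shortNegRecip (α : ℂ) s)) ∧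
    (KGt α κ s → KGt α (κ - 1) (shortNegRecip (α : ℂ) s)) ∧
    (∀ m : ℕ, (m : ℕ∞) ≤ κ → KCDAt α m κ s →
      KCDAt α (max 0 (m - 1)) (κ - 1) (shortNegRecip (α : ℂ) s)) ∧
    (KCD α κ s → KCD α (κ - 1) (shortNegRecip (α : ℂ) s)) := by
  obtain ⟨κ, rfl⟩ : ∃ μ, κ = μ + 1 := ⟨κ - 1, (tsub_add_cancel_of_le hκ).symm⟩
  rw [(ENat.addLECancellable_of_ne_top ENat.one_ne_top).add_tsub_cancel_right]
  simp only [Nat.zero_max]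
  exact ⟨KGe.shortNegRecip, KGeExt.shortNegRecip, KGt.shortNegRecip,
    fun _ _ => KCDAt.shortNegRecip, KCD.shortNegRecip⟩
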